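/- **Setting (two-way node popularity model).** Let $n,m\ge 1$ and let $K,L$ be known numbers of communities. Let $c_*\in[K]^n$ and $z_*\in[L]^m$ be the true out- and in-community assignments, and let $C_*\in\{0,1\}^{n\times K}$, $Z_*\in\{0,1\}^{m\times L}$ be the corresponding clustering matrices ($C_{*,ik}=1$ iff $c_{*,i}=k$, $Z_{*,jl}=1$ iff $z_{*,j}=l$). Let $A\in\mathbb R^{n\times m}$ be a random matrix with mutually independent entries, with mean $P_*=\mathbb E A$, $$P_{*,ij}=\Lambda_{i,z_{*,j}}\,\widetilde\Lambda_{j,c_{*,i}},\qquad \Lambda\in\mathbb R^{n\times L},\ \widetilde\Lambda\in\mathbb R^{m\times K},$$ and with sub-Gaussian entries: $\mathbb E\exp(t(A_{ij}-P_{*,ij}))\le\exp(\sigma_{ij}^2t^2/2)$ for all $t\in\mathbb R$. Put $\sigma_{\max}^2=\max_{i,j}\sigma_{ij}^2$. Assume: * (A1) all entries of $\Lambda$ and $\widetilde\Lambda$ are positive; * (A2) for every $k$, any $L$ rows of $\Lambda$ whose indices lie in out-community $k$ are linearly independent, and for every $l$, any $K$ rows of $\widetilde\Lambda$ whose indices lie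 in in-community $l$ are linearly independent; * (A3) $n\ge K^2L$ or $m\ge L^2K$. For a matrix $B\in\mathbb R^{n\times m}$ and assignments $(c,z)\in[K]^n\times[L]^m$ with clustering matrices $(C,Z)$, write $B^{(k,l)}(C,Z)$ for the submatrix of $B$ with rows $\{i:c_i=k\}$ and columns $\{j:z_j=l\}$. Let $\Pi_1(M)=\sigma_1uv^T$ be the rank-one projection of $M$ ($\sigma_1$ the largest singular value, $u,v$ corresponding unit singular vectors). Let $(\widehat C,\widehat Z)$ be the clustering matrices of any global minimizer over $(c,z)\in[K]^n\times[L]^m$ of $$\sum_{k=1}^K\sum_{l=1}^L\bigl\|A^{(k,l)}(C,Z)-\Pi_1\{A^{(k,l)}(C,Z)\}\bigr\|_F^2 .$$ Define $\operatorname{Err}(C,C_*)=(2n)^{-1}\min_{Q}\|CQ-C_*\|_1$ and $\operatorname{Err}(Z,Z_*)=(2m)^{-1}\min_{Q}\|ZQ-Z_*\|_1$ (entrywise $\ell_1$ norm, $Q$ ranging over the $K\times K$, resp. $L\times L$, permutation matrices), and for $\rho\in(0,1)$ let $\Upsilon(\rho)$ be the set of pairs $(C,Z)$ of clustering matrices with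 $\max\{\operatorname{Err}(C,C_*),\operatorname{Err}(Z,Z_*)\}\ge\rho$. **Theorem.** For every $\alpha\in(0,1/2)$ there are constants $H_1,H_2>0$, depending only on $\alpha$, such that the following holds for all $n,m,K,L$ and all models as above. If $\rho_{n,m}\in(0,1)$ satisfies $$\|P_*\|_F^2-(1+\alpha)\max_{(C,Z)\in\Upsilon(\rho_{n,m})}\sum_{k=1}^K\sum_{l=1}^L\|P_*^{(k,l)}(C,Z)\|_{op}^2$$ $$\ge\ \sigma_{\max}^2\Bigl[H_1\bigl\{nL+mK+KL\log(2KL)+KL(m+n)\bigr\}+H_2KL\,(n\log K+m\log L)\Bigr]$$ (the maximum over an empty set being $0$), then with probability at least $1-2e^{-(n+m)}$, $$\max\{\operatorname{Err}(\widehat C,C_*),\operatorname{Err}(\widehat Z,Z_*)\}\le\rho_{n,m}.$$ -/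

import Mathlib

open MeasureTheory ProbabilityTheory
open scoped NNReal Matrix

noncomputable section

namespace TNPM

/-! ### Matrices, blocks, and the rank-one projection -/

/-- The squared Frobenius norm of a real matrix. -/
def frobSq {ι κ : Type*} [Fintype ι] [Fintype κ] (B : Matrix ι κ ℝ) : ℝ :=
  ∑ i, ∑ j, B i j ^ 2

/-- The operator norm of a real matrix between Euclidean spaces, i.e. its largest singular value. -/
def opNorm {ι κ : Type*} [Fintype ι] [Fintype κ] [DecidableEq κ] (B : Matrix ι κ ℝ) : ℝ :=
  ‖LinearMap.toContinuousLinearMap (Matrix.toEuclideanLin B)‖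

/-- `(u, v)` is a pair of left and right unit singular vectors of `B` for its largest singular
value. -/
def IsTopSingularPair {ι κ : Type*} [Fintype ι] [Fintype κ] [DecidableEq κ]
    (B : Matrix ι κ ℝ) (u : ι → ℝ) (v : κ → ℝ) : Prop :=
  u ⬝ᵥ u = 1 ∧ v ⬝ᵥ v = 1 ∧ B *ᵥ v = opNorm B • u ∧ Bᵀ *ᵥ u = opNorm B • v

open Classical in
/-- The rank-one projection `σ₁ u vᵀ` of `B`, with `σ₁` the largest singular value and `u`, `v`
corresponding unit singular vectors. Such vectors exist for every matrix with at least one row and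
one column; a matrix without entries is projected to itself. -/
def rankOneProj {ι κ : Type*} [Fintype ι] [Fintype κ] [DecidableEq κ]
    (B : Matrix ι κ ℝ) : Matrix ι κ ℝ :=
  if h : ∃ p : (ι → ℝ) × (κ → ℝ), IsTopSingularPair B p.1 p.2 then
    opNorm B • Matrix.vecMulVec h.choose.1 h.choose.2
  else 0

/-- The `(k, l)` block of `B` for the assignments `c` of the rows and `z` of the columns. -/
def block {n m K L : ℕ} (B : Matrix (Fin n) (Fin m) ℝ) (c : Fin n → Fin K) (z : Fin m → Fin L)
    (k : Fin K) (l : Fin L) : Matrix {i // c i = k} {j // z j = l} ℝ :=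
  B.submatrix Subtype.val Subtype.val

/-! ### The model -/

/-- The mean matrix `P i j = Λ i (z j) * Λ' j (c i)`. -/
def meanMatrix {n m K L : ℕ} (Λ : Matrix (Fin n) (Fin L) ℝ) (Λ' : Matrix (Fin m) (Fin K) ℝ)
    (c : Fin n → Fin K) (z : Fin m → Fin L) : Matrix (Fin n) (Fin m) ℝ :=
  fun i j => Λ i (z j) * Λ' j (c i)

/-- The random matrix `A` follows the two-way node popularity model with popularity parameters
`Λ`, `Λ'`, communities `c`, `z` and sub-Gaussian variance proxies `s i j` (playing the role of
`σ_ij ^ 2`). -/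
structure IsModel {n m K L : ℕ} {Ω : Type*} [MeasurableSpace Ω] (μ : Measure Ω)
    (A : Ω → Matrix (Fin n) (Fin m) ℝ)
    (Λ : Matrix (Fin n) (Fin L) ℝ) (Λ' : Matrix (Fin m) (Fin K) ℝ)
    (c : Fin n → Fin K) (z : Fin m → Fin L) (s : Fin n → Fin m → ℝ≥0) : Prop where
  measurable : ∀ i j, Measurable fun ω => A ω i j
  indep : iIndepFun (fun (p : Fin n × Fin m) ω => A ω p.1 p.2) μ
  integrable : ∀ i j, Integrable (fun ω => A ω i j) μ
  mean : ∀ i j, ∫ ω, A ω i j ∂μ = meanMatrix Λ Λ' c z i j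
  subGaussian : ∀ i j,
    HasSubgaussianMGF (fun ω => A ω i j - meanMatrix Λ Λ' c z i j) (s i j) μ

/-- The maximal variance proxy `σ_max ^ 2`. -/
def maxProxy {n m : ℕ} (s : Fin n → Fin m → ℝ≥0) : ℝ≥0 :=
  Finset.univ.sup fun p : Fin n × Fin m => s p.1 p.2

/-- Any `d` rows of `M` (a matrix with `d` columns) that belong to the same community of `c` are
linearly independent. -/
def InGeneralPosition {N q d : ℕ} (M : Matrix (Fin N) (Fin d) ℝ) (c : Fin N → Fin q) : Prop :=
  ∀ (k : Fin q) (S : Finset (Fin N)), (∀ i ∈ S, c i = k) → S.card = d →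
    LinearIndependent ℝ fun i : S => M i

/-! ### The estimator -/

/-- The sum over all blocks of the squared Frobenius distance to the rank-one projection. -/
def loss {n m K L : ℕ} (B : Matrix (Fin n) (Fin m) ℝ) (c : Fin n → Fin K) (z : Fin m → Fin L) :
    ℝ :=
  ∑ k, ∑ l, frobSq (block B c z k l - rankOneProj (block B c z k l))

/-- `(c, z)` is a global minimizer of the loss over all assignments to `K` and `L` communities. -/
def IsLossMinimizer {n m K L : ℕ} (B : Matrix (Fin n) (Fin m) ℝ)
    (c : Fin n → Fin K) (z : Fin m → Fin L) : Prop :=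
  ∀ (c' : Fin n → Fin K) (z' : Fin m → Fin L), loss B c z ≤ loss B c' z'

/-! ### Misclassification -/

/-- The `0`-`1` clustering matrix of an assignment. -/
def clusterMatrix {N q : ℕ} (c : Fin N → Fin q) : Matrix (Fin N) (Fin q) ℝ :=
  fun i k => if c i = k then 1 else 0

/-- The proportion of misclassified nodes
`(2 N)⁻¹ * min_Q ‖C Q - C₀‖₁`, with `Q` ranging over the permutation matrices. -/
def err {N q : ℕ} (c c₀ : Fin N → Fin q) : ℝ :=
  (2 * (N : ℝ))⁻¹ * ⨅ π : Equiv.Perm (Fin q),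
    ∑ i, ∑ k, |(clusterMatrix c * π.permMatrix ℝ - clusterMatrix c₀) i k|

/-- The pairs of assignments for which the proportion of misclassified nodes is at least `ρ` in
one of the two node sets. -/
def badClusterings {n m K L : ℕ} (c₀ : Fin n → Fin K) (z₀ : Fin m → Fin L) (ρ : ℝ) :
    Set ((Fin n → Fin K) × (Fin m → Fin L)) :=
  {p | ρ ≤ max (err p.1 c₀) (err p.2 z₀)}

/-- The sum over all blocks of the squared operator norms. -/
def blockOpSq {n m K L : ℕ} (B : Matrix (Fin n) (Fin m) ℝ)
    (c : Fin n → Fin K) (z : Fin m → Fin L) : ℝ :=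
  ∑ k, ∑ l, opNorm (block B c z k l) ^ 2

/-- The maximum of `blockOpSq` over the (finitely many) pairs in `badClusterings`; it is `0` if
there are none. -/
def maxBadBlockOpSq {n m K L : ℕ} (B : Matrix (Fin n) (Fin m) ℝ)
    (c₀ : Fin n → Fin K) (z₀ : Fin m → Fin L) (ρ : ℝ) : ℝ :=
  sSup ((fun p => blockOpSq B p.1 p.2) '' badClusterings c₀ z₀ ρ)

/-- The bracket
`H₁ {n L + m K + K L log (2 K L) + K L (m + n)} + H₂ K L (n log K + m log L)`. -/
def noiseBound (H₁ H₂ : ℝ) (n m K L : ℕ) : ℝ :=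
  H₁ * ((n : ℝ) * L + m * K + K * L * Real.log (2 * K * L) + K * L * ((m : ℝ) + n)) +
    H₂ * (K * L * (n * Real.log K + m * Real.log L))

end TNPM

end

/-!
The loss of a pair of assignments is `‖A‖_F²` minus the sum of the squared operator norms of the
blocks (`TNPM.loss_eq`), so the estimator maximizes `blockOpSq A`. At the true communities every
block of the mean matrix `P` has rank one, whence `blockOpSq P c₀ z₀ = ‖P‖_F²`. Comparing the
estimator with the truth and passing between `A` and `P` twice gives, for every `δ > 0`,
`‖P‖_F² ≤ (1 + δ)² blockOpSq P ĉ ẑ + C(δ) K L ‖A - P‖_op²`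
(`TNPM.frobSq_meanMatrix_le_of_isLossMinimizer`), because every block of the noise has operator
norm at most `‖A - P‖_op`. A union bound over nets of the two balls, with the Chernoff bound for
each value of the bilinear form, shows `‖A - P‖_op² ≤ 96 σ_max² (n + m)` outside an event of
probability `exp (-(n + m))` (`TNPM.measureReal_opNorm_sq_gt_le`). If the estimator were a bad
clustering on this event, the noise term would be dominated by the term `K L (m + n)` of the
separation condition, and with `(1 + δ)² < 1 + α` the two inequalities would contradict
`‖P‖_F² > 0`.

The event in the conclusion need not be measurable, so its measure is bounded below by
subadditivity.
-/

namespace TNPM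

/-! ### The operator norm in coordinates -/

section OpNorm

variable {ι κ ι' κ' : Type*} [Fintype ι] [Fintype κ] [DecidableEq κ] [Fintype ι'] [Fintype κ']
  [DecidableEq κ']

lemma opNorm_nonneg (B : Matrix ι κ ℝ) : 0 ≤ opNorm B := norm_nonneg _

lemma dotProduct_self_eq_norm_sq (v : ι → ℝ) : v ⬝ᵥ v = ‖WithLp.toLp 2 v‖ ^ 2 := by
  rw [EuclideanSpace.real_norm_sq_eq]
  simp [dotProduct, sq]

lemma dotProduct_eq_inner (u v : ι → ℝ) : u ⬝ᵥ v = inner ℝ (WithLp.toLp 2 u) (WithLp.toLp 2 v) := by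
  simp [PiLp.inner_apply, dotProduct, mul_comm]

lemma mulVec_dotProduct_self_le (B : Matrix ι κ ℝ) (v : κ → ℝ) :
    (B *ᵥ v) ⬝ᵥ (B *ᵥ v) ≤ opNorm B ^ 2 * (v ⬝ᵥ v) := by
  rw [dotProduct_self_eq_norm_sq, dotProduct_self_eq_norm_sq, ← mul_pow]
  have h := (LinearMap.toContinuousLinearMap (Matrix.toEuclideanLin B)).le_opNorm (WithLp.toLp 2 v)
  exact pow_le_pow_left₀ (norm_nonneg _) h 2

lemma opNorm_le_of_forall (B : Matrix ι κ ℝ) {r : ℝ} (hr : 0 ≤ r)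
    (h : ∀ v : κ → ℝ, (B *ᵥ v) ⬝ᵥ (B *ᵥ v) ≤ r ^ 2 * (v ⬝ᵥ v)) : opNorm B ≤ r := by
  refine ContinuousLinearMap.opNorm_le_bound _ hr fun x => ?_
  have h' := h x.ofLp
  rw [dotProduct_self_eq_norm_sq, dotProduct_self_eq_norm_sq, ← mul_pow] at h'
  exact (sq_le_sq₀ (norm_nonneg _) (by positivity)).1 h'

lemma opNorm_add_le (B E : Matrix ι κ ℝ) : opNorm (B + E) ≤ opNorm B + opNorm E := by
  unfold opNorm
  rw [map_add, map_add]
  exact norm_add_le _ _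

lemma opNorm_sub_comm (B E : Matrix ι κ ℝ) : opNorm (B - E) = opNorm (E - B) := by
  unfold opNorm
  rw [map_sub, map_sub, map_sub, map_sub]
  exact norm_sub_rev _ _

/-- The operator norm is attained at a unit vector, by compactness of the unit sphere. -/
lemma exists_unit_mulVec_eq [Nonempty κ] (B : Matrix ι κ ℝ) :
    ∃ v : κ → ℝ, v ⬝ᵥ v = 1 ∧ (B *ᵥ v) ⬝ᵥ (B *ᵥ v) = opNorm B ^ 2 := by
  set T := LinearMap.toContinuousLinearMap (Matrix.toEuclideanLin B)
  obtain ⟨x, hx, hmax⟩ := (isCompact_sphere (0 : EuclideanSpace ℝ κ) 1).exists_isMaxOn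
    (NormedSpace.sphere_nonempty.2 zero_le_one) (T.continuous.norm.continuousOn)
  have hx1 : ‖x‖ = 1 := by simpa using hx
  refine ⟨x.ofLp, by rw [dotProduct_self_eq_norm_sq]; simp [hx1], ?_⟩
  have hTx : (B *ᵥ x.ofLp) ⬝ᵥ (B *ᵥ x.ofLp) = ‖T x‖ ^ 2 := dotProduct_self_eq_norm_sq _
  have hle : opNorm B ≤ ‖T x‖ := by
    refine ContinuousLinearMap.opNorm_le_of_unit_norm (norm_nonneg _) fun y hy => ?_
    exact hmax (by simpa using hy)
  have hge : ‖T x‖ ≤ opNorm B := by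
    have h := T.le_opNorm x
    rwa [hx1, mul_one] at h
  rw [hTx, le_antisymm hge hle]

lemma opNorm_submatrix_le (B : Matrix ι κ ℝ) {f : ι' → ι} {g : κ' → κ}
    (hf : f.Injective) (hg : g.Injective) : opNorm (B.submatrix f g) ≤ opNorm B := by
  refine opNorm_le_of_forall _ (opNorm_nonneg B) fun v => ?_
  classical
  set w : κ → ℝ := Function.extend g v 0
  have hw0 : ∀ j ∉ Set.range g, w j = 0 := fun j hj =>
    Function.extend_apply' _ _ _ (by simpa using hj)
  have hwg : ∀ j, w (g j) = v j := fun j => hg.extend_apply _ _ _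
  have hBw : ∀ i, (B.submatrix f g *ᵥ v) i = (B *ᵥ w) (f i) := fun i =>
    Fintype.sum_of_injective g hg _ _ (fun j hj => by simp [hw0 j hj]) (fun j => by simp [hwg])
  have hww : v ⬝ᵥ v = w ⬝ᵥ w :=
    Fintype.sum_of_injective g hg _ _ (fun j hj => by simp [hw0 j hj]) (fun j => by simp [hwg])
  rw [hww]
  refine le_trans ?_ (mulVec_dotProduct_self_le B w)
  simp only [dotProduct, hBw]
  rw [← Finset.sum_image (s := Finset.univ) (g := f)
    (f := fun i => (B *ᵥ w) i * (B *ᵥ w) i) hf.injOn]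
  exact Finset.sum_le_sum_of_subset_of_nonneg (Finset.subset_univ _)
    fun i _ _ => mul_self_nonneg _

end OpNorm

/-! ### The rank-one projection and the loss -/

section Projection

variable {ι κ : Type*} [Fintype ι] [Fintype κ] [DecidableEq κ]

/-- With `v` attaining the operator norm `σ > 0` and `u = σ⁻¹ B v`, one has `⟨Bᵀ u, v⟩ = σ` and
`‖Bᵀ u‖ ≤ σ`, which forces `Bᵀ u = σ v`. For `B = 0` any two unit vectors do. -/
lemma exists_isTopSingularPair [Nonempty ι] [Nonempty κ] (B : Matrix ι κ ℝ) :
    ∃ p : (ι → ℝ) × (κ → ℝ), IsTopSingularPair B p.1 p.2 := by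
  classical
  obtain ⟨v, hv, hBv⟩ := exists_unit_mulVec_eq B
  rcases (opNorm_nonneg B).eq_or_lt with h0 | hpos
  · have hB : ∀ w : κ → ℝ, B *ᵥ w = 0 := fun w => by
      have h := mulVec_dotProduct_self_le B w
      rw [← h0] at h
      exact dotProduct_self_eq_zero.1 (le_antisymm (by simpa using h)
        (Finset.sum_nonneg fun _ _ => mul_self_nonneg _))
    have hBz : B = 0 := by
      ext i j
      simpa using congrFun (hB (Pi.single j 1)) i
    refine ⟨(Pi.single (Classical.arbitrary ι) 1, v), by simp, hv, ?_, ?_⟩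
    · simp [hB, ← h0]
    · rw [← h0, hBz, Matrix.transpose_zero, Matrix.zero_mulVec, zero_smul]
  · set σ := opNorm B
    set u : ι → ℝ := σ⁻¹ • (B *ᵥ v) with hu
    have hBvu : B *ᵥ v = σ • u := by rw [hu, smul_smul, mul_inv_cancel₀ hpos.ne', one_smul]
    have huu : u ⬝ᵥ u = 1 := by
      rw [hu, smul_dotProduct, dotProduct_smul, hBv]
      simp only [smul_eq_mul]
      field_simp
    refine ⟨(u, v), huu, hv, hBvu, ?_⟩
    set w : κ → ℝ := Bᵀ *ᵥ u with hw
    have hwx : ∀ x : κ → ℝ, w ⬝ᵥ x = u ⬝ᵥ (B *ᵥ x) := fun x => by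
      rw [hw, Matrix.mulVec_transpose, Matrix.dotProduct_mulVec]
    have hwv : w ⬝ᵥ v = σ := by rw [hwx, hBvu, dotProduct_smul, huu]; simp
    -- `‖w‖² = ⟨u, B w⟩ ≤ ‖B w‖ ≤ σ ‖w‖`, in squared form.
    have hww : (w ⬝ᵥ w) ^ 2 ≤ σ ^ 2 * (w ⬝ᵥ w) := by
      refine le_trans ?_ (mulVec_dotProduct_self_le B w)
      rw [hwx]
      have h := Finset.sum_mul_sq_le_sq_mul_sq Finset.univ u (B *ᵥ w)
      have h1 : ∑ i, u i ^ 2 = 1 := by rw [← huu]; simp [dotProduct, sq]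
      rw [h1, one_mul] at h
      simpa [dotProduct, sq] using h
    have hww' : w ⬝ᵥ w ≤ σ ^ 2 := by
      rcases (show 0 ≤ w ⬝ᵥ w from Finset.sum_nonneg fun _ _ => mul_self_nonneg _).eq_or_lt
        with h | h
      · rw [← h]; positivity
      · exact le_of_mul_le_mul_right (by rwa [sq] at hww) h
    have hd : (w - σ • v) ⬝ᵥ (w - σ • v) = w ⬝ᵥ w - σ ^ 2 := by
      simp only [sub_dotProduct, dotProduct_sub, smul_dotProduct, dotProduct_smul, hv, hwv,
        dotProduct_comm v w, smul_eq_mul]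
      ring
    have hz : w - σ • v = 0 := dotProduct_self_eq_zero.1 (le_antisymm (by rw [hd]; linarith)
      (Finset.sum_nonneg fun _ _ => mul_self_nonneg _))
    exact sub_eq_zero.1 hz

/-- Pythagoras for the best rank-one approximation. For a matrix without entries every term
vanishes, so no hypothesis on the index types is needed. -/
lemma frobSq_sub_rankOneProj (B : Matrix ι κ ℝ) :
    frobSq (B - rankOneProj B) = frobSq B - opNorm B ^ 2 := by
  unfold rankOneProj
  split_ifs with h
  · obtain ⟨hu, hv, hBv, -⟩ := h.choose_spec
    set u := h.choose.1
    set v := h.choose.2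
    set σ := opNorm B
    have huBv : ∑ i, ∑ j, u i * (B i j * v j) = σ := by
      have h1 : u ⬝ᵥ (B *ᵥ v) = σ := by rw [hBv, dotProduct_smul, hu]; simp
      rw [← h1]
      simp only [dotProduct, Matrix.mulVec, Finset.mul_sum]
    have huv : ∑ i, ∑ j, (u i * u i) * (v j * v j) = 1 := by
      rw [← Finset.sum_mul_sum]
      exact (congrArg₂ (· * ·) hu hv).trans (one_mul 1)
    have hexp : frobSq (B - σ • Matrix.vecMulVec u v) = frobSq B
        - 2 * σ * (∑ i, ∑ j, u i * (B i j * v j))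
        + σ ^ 2 * ∑ i, ∑ j, (u i * u i) * (v j * v j) := by
      simp only [frobSq, Finset.mul_sum, ← Finset.sum_add_distrib, ← Finset.sum_sub_distrib]
      refine Finset.sum_congr rfl fun i _ => Finset.sum_congr rfl fun j _ => ?_
      simp only [Matrix.sub_apply, Matrix.smul_apply, Matrix.vecMulVec_apply, smul_eq_mul]
      ring
    rw [hexp, huBv, huv]
    ring
  · have hempty : IsEmpty ι ∨ IsEmpty κ := by
      by_contra hne
      simp only [not_or, not_isEmpty_iff] at hne
      obtain ⟨h1, h2⟩ := hne
      exact h (exists_isTopSingularPair B)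
    have hop : opNorm B = 0 := by
      refine le_antisymm (opNorm_le_of_forall _ le_rfl fun v => ?_) (opNorm_nonneg B)
      rcases hempty with h | h <;> simp [Matrix.mulVec, dotProduct]
    simp [hop]

/-- A rank-one matrix has equal Frobenius and operator norms; only the nontrivial inequality is
stated. -/
lemma frobSq_vecMulVec_le (a : ι → ℝ) (b : κ → ℝ) :
    frobSq (Matrix.vecMulVec a b) ≤ opNorm (Matrix.vecMulVec a b) ^ 2 := by
  have hfrob : frobSq (Matrix.vecMulVec a b) = (a ⬝ᵥ a) * (b ⬝ᵥ b) := by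
    simp only [frobSq, dotProduct, Finset.sum_mul_sum, Matrix.vecMulVec_apply]
    exact Finset.sum_congr rfl fun i _ => Finset.sum_congr rfl fun j _ => by ring
  have h := mulVec_dotProduct_self_le (Matrix.vecMulVec a b) b
  have hb : Matrix.vecMulVec a b *ᵥ b = (b ⬝ᵥ b) • a := by
    ext i
    simp only [Matrix.mulVec, dotProduct, Matrix.vecMulVec_apply, Pi.smul_apply, smul_eq_mul,
      Finset.sum_mul]
    exact Finset.sum_congr rfl fun j _ => by ring
  rw [hb, smul_dotProduct, dotProduct_smul, smul_eq_mul, smul_eq_mul] at h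
  rw [hfrob]
  rcases (show 0 ≤ b ⬝ᵥ b from Finset.sum_nonneg fun _ _ => mul_self_nonneg _).eq_or_lt
    with h0 | h0
  · rw [← h0, mul_zero]; positivity
  · exact le_of_mul_le_mul_right (by linarith) h0

end Projection

section Blocks

variable {n m K L : ℕ}

lemma sum_frobSq_block (B : Matrix (Fin n) (Fin m) ℝ) (c : Fin n → Fin K) (z : Fin m → Fin L) :
    ∑ k, ∑ l, frobSq (block B c z k l) = frobSq B := by
  simp only [frobSq, block, Matrix.submatrix_apply]
  calc ∑ k, ∑ l, ∑ i : {i // c i = k}, ∑ j : {j // z j = l}, B i j ^ 2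
      = ∑ k, ∑ i : {i // c i = k}, ∑ l, ∑ j : {j // z j = l}, B i j ^ 2 :=
        Finset.sum_congr rfl fun k _ => Finset.sum_comm
    _ = ∑ k, ∑ i : {i // c i = k}, ∑ j, B i j ^ 2 :=
        Finset.sum_congr rfl fun k _ => Finset.sum_congr rfl fun i _ =>
          Fintype.sum_fiberwise z fun j => B i j ^ 2
    _ = ∑ i, ∑ j, B i j ^ 2 := Fintype.sum_fiberwise c fun i => ∑ j, B i j ^ 2

/-- Minimizing the loss amounts to maximizing `blockOpSq`. -/
lemma loss_eq (B : Matrix (Fin n) (Fin m) ℝ) (c : Fin n → Fin K) (z : Fin m → Fin L) :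
    loss B c z = frobSq B - blockOpSq B c z := by
  simp only [loss, blockOpSq, frobSq_sub_rankOneProj, Finset.sum_sub_distrib, sum_frobSq_block]

/-- Every block of the mean matrix for the true communities has rank one. -/
lemma frobSq_meanMatrix_le (Λ : Matrix (Fin n) (Fin L) ℝ) (Λ' : Matrix (Fin m) (Fin K) ℝ)
    (c : Fin n → Fin K) (z : Fin m → Fin L) :
    frobSq (meanMatrix Λ Λ' c z) ≤ blockOpSq (meanMatrix Λ Λ' c z) c z := by
  rw [← sum_frobSq_block _ c z, blockOpSq]
  refine Finset.sum_le_sum fun k _ => Finset.sum_le_sum fun l _ => ?_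
  have h : block (meanMatrix Λ Λ' c z) c z k l =
      Matrix.vecMulVec (fun i : {i // c i = k} => Λ i l) (fun j : {j // z j = l} => Λ' j k) := by
    ext i j
    simp [block, meanMatrix, Matrix.vecMulVec_apply, i.2, j.2]
  rw [h]
  exact frobSq_vecMulVec_le _ _

lemma blockOpSq_nonneg (B : Matrix (Fin n) (Fin m) ℝ) (c : Fin n → Fin K) (z : Fin m → Fin L) :
    0 ≤ blockOpSq B c z :=
  Finset.sum_nonneg fun _ _ => Finset.sum_nonneg fun _ _ => sq_nonneg _

/-- Perturbation of `blockOpSq`: each block of the perturbation is bounded by the operator norm of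
the whole, and `(x + y)² ≤ (1 + δ) x² + (1 + δ⁻¹) y²`. -/
lemma blockOpSq_le (B B' : Matrix (Fin n) (Fin m) ℝ) (c : Fin n → Fin K) (z : Fin m → Fin L)
    {δ : ℝ} (hδ : 0 < δ) :
    blockOpSq B c z ≤
      (1 + δ) * blockOpSq B' c z + (1 + δ⁻¹) * (K * L * opNorm (B - B') ^ 2) := by
  have hblock : ∀ k l, opNorm (block B c z k l) ^ 2 ≤
      (1 + δ) * opNorm (block B' c z k l) ^ 2 + (1 + δ⁻¹) * opNorm (B - B') ^ 2 := by
    intro k l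
    have hsplit : block B c z k l = block B' c z k l + block (B - B') c z k l := by
      ext i j; simp [block]
    have h1 : opNorm (block B c z k l) ≤ opNorm (block B' c z k l) + opNorm (B - B') := by
      rw [hsplit]
      exact (opNorm_add_le _ _).trans (by
        gcongr
        exact opNorm_submatrix_le _ Subtype.val_injective Subtype.val_injective)
    set x := opNorm (block B' c z k l)
    set y := opNorm (B - B')
    refine (pow_le_pow_left₀ (opNorm_nonneg _) h1 2).trans ?_
    have h2 : (1 + δ) * x ^ 2 + (1 + δ⁻¹) * y ^ 2 - (x + y) ^ 2 = δ⁻¹ * (δ * x - y) ^ 2 := by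
      field_simp
      ring
    have h3 : 0 ≤ δ⁻¹ * (δ * x - y) ^ 2 := by positivity
    linarith
  refine (Finset.sum_le_sum fun k _ => Finset.sum_le_sum fun l _ => hblock k l).trans_eq ?_
  simp only [blockOpSq, Finset.sum_add_distrib, ← Finset.mul_sum, Finset.sum_const,
    Finset.card_univ, Fintype.card_fin, nsmul_eq_mul]
  ring

/-- The basic inequality for the estimator: the minimality of the loss at `(c, z)` and two uses of
`blockOpSq_le`, at `(c, z)` and at the true communities. -/
lemma frobSq_meanMatrix_le_of_isLossMinimizer {A : Matrix (Fin n) (Fin m) ℝ}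
    (Λ : Matrix (Fin n) (Fin L) ℝ) (Λ' : Matrix (Fin m) (Fin K) ℝ)
    (c₀ : Fin n → Fin K) (z₀ : Fin m → Fin L) {c : Fin n → Fin K} {z : Fin m → Fin L}
    (h : IsLossMinimizer A c z) {δ : ℝ} (hδ : 0 < δ) :
    frobSq (meanMatrix Λ Λ' c₀ z₀) ≤ (1 + δ) ^ 2 * blockOpSq (meanMatrix Λ Λ' c₀ z₀) c z +
      2 * ((1 + δ) * (1 + δ⁻¹)) * (K * L * opNorm (A - meanMatrix Λ Λ' c₀ z₀) ^ 2) := by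
  set P := meanMatrix Λ Λ' c₀ z₀
  set X : ℝ := K * L * opNorm (A - P) ^ 2
  have hX : 0 ≤ X := by positivity
  have h0 : frobSq P ≤ blockOpSq P c₀ z₀ := frobSq_meanMatrix_le Λ Λ' c₀ z₀
  have h1 : blockOpSq P c₀ z₀ ≤ (1 + δ) * blockOpSq A c₀ z₀ + (1 + δ⁻¹) * X := by
    have := blockOpSq_le P A c₀ z₀ hδ
    rwa [opNorm_sub_comm] at this
  have h2 : blockOpSq A c₀ z₀ ≤ blockOpSq A c z := by
    have := h c₀ z₀
    rw [loss_eq, loss_eq] at this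
    linarith
  have h3 : blockOpSq A c z ≤ (1 + δ) * blockOpSq P c z + (1 + δ⁻¹) * X := blockOpSq_le A P c z hδ
  have h4 := mul_le_mul_of_nonneg_left (h2.trans h3) (show 0 ≤ 1 + δ by positivity)
  have h5 : 0 ≤ δ * ((1 + δ⁻¹) * X) := by positivity
  nlinarith

end Blocks

/-! ### Operator norm of a sub-Gaussian matrix -/

/-- The ball of radius `2` in a Euclidean space has a `1`-net of cardinality at most `5 ^ d`: a
`1`-separated subset of largest cardinality. -/
lemma exists_net (ι : Type*) [Fintype ι] :
    ∃ S : Finset (EuclideanSpace ℝ ι), S.card ≤ 5 ^ Fintype.card ι ∧ (∀ x ∈ S, ‖x‖ ≤ 2) ∧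
      ∀ x : EuclideanSpace ℝ ι, ‖x‖ ≤ 2 → ∃ y ∈ S, ‖x - y‖ ≤ 1 := by
  classical
  let Sep : Finset (EuclideanSpace ℝ ι) → Prop := fun S =>
    (∀ x ∈ S, ‖x‖ ≤ 2) ∧ ∀ x ∈ S, ∀ y ∈ S, x ≠ y → 1 ≤ ‖x - y‖
  have hcard : ∀ S, Sep S → S.card ≤ 5 ^ Fintype.card ι := fun S hS => by
    simpa using Besicovitch.card_le_of_separated S hS.1 hS.2
  let Q : ℕ → Prop := fun k => ∃ S, Sep S ∧ S.card = k
  have hQ0 : Q 0 := ⟨∅, ⟨by simp, by simp⟩, by simp⟩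
  obtain ⟨S, hS, hSk⟩ := Nat.findGreatest_spec (P := Q) (Nat.zero_le (5 ^ Fintype.card ι)) hQ0
  refine ⟨S, hcard S hS, hS.1, fun x hx => ?_⟩
  by_contra! hfar
  have hxS : x ∉ S := fun hxS => by
    have := hfar x hxS
    simp only [sub_self, norm_zero] at this
    linarith
  have hins : Sep (insert x S) := by
    refine ⟨fun y hy => ?_, fun y hy w hw hyw => ?_⟩
    · rcases Finset.mem_insert.1 hy with rfl | hy
      exacts [hx, hS.1 y hy]
    · rcases Finset.mem_insert.1 hy with rfl | hy' <;> rcases Finset.mem_insert.1 hw with rfl | hw'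
      · exact absurd rfl hyw
      · exact (hfar w hw').le
      · rw [norm_sub_rev]; exact (hfar y hy').le
      · exact hS.2 y hy' w hw' hyw
  have := Nat.le_findGreatest (P := Q) (hcard _ hins) ⟨_, hins, rfl⟩
  rw [Finset.card_insert_of_notMem hxS, ← hSk] at this
  omega

/-- Discretization of the operator norm as a supremum of the bilinear form. -/
lemma opNorm_le_of_net {ι κ : Type*} [Fintype ι] [Fintype κ] [DecidableEq κ]
    {S : Finset (EuclideanSpace ℝ ι)} {S' : Finset (EuclideanSpace ℝ κ)}
    (hS : ∀ x : EuclideanSpace ℝ ι, ‖x‖ ≤ 2 → ∃ y ∈ S, ‖x - y‖ ≤ 1)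
    (hS' : ∀ x : EuclideanSpace ℝ κ, ‖x‖ ≤ 2 → ∃ y ∈ S', ‖x - y‖ ≤ 1)
    (B : Matrix ι κ ℝ) {t : ℝ} (ht : 0 ≤ t)
    (h : ∀ y ∈ S, ∀ x ∈ S', y.ofLp ⬝ᵥ (B *ᵥ x.ofLp) ≤ t) : opNorm B ≤ t := by
  -- A vector is at most `t` in norm as soon as its inner products with the net are.
  have hvec : ∀ w : EuclideanSpace ℝ ι, (∀ y ∈ S, inner ℝ y w ≤ t) → ‖w‖ ≤ t := by
    intro w hw
    rcases eq_or_ne w 0 with rfl | hw0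
    · simpa using ht
    have hn : 0 < ‖w‖ := norm_pos_iff.2 hw0
    obtain ⟨y, hy, hxy⟩ := hS ((2 * ‖w‖⁻¹) • w) (by
      rw [norm_smul]; simp only [norm_mul, norm_inv, norm_norm, Real.norm_ofNat]; field_simp; rfl)
    have h1 : inner ℝ ((2 * ‖w‖⁻¹) • w) w = 2 * ‖w‖ := by
      rw [real_inner_smul_left, real_inner_self_eq_norm_sq]
      field_simp
    have h2 : inner ℝ ((2 * ‖w‖⁻¹) • w - y) w ≤ 1 * ‖w‖ :=
      (real_inner_le_norm _ _).trans (by gcongr)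
    rw [inner_sub_left, h1] at h2
    linarith [hw y hy]
  set T := LinearMap.toContinuousLinearMap (Matrix.toEuclideanLin B) with hT
  have hnet : ∀ x ∈ S', ‖T x‖ ≤ t := fun x hx => hvec _ fun y hy => by
    have := h y hy x hx
    rwa [dotProduct_eq_inner] at this
  -- Bounding `T` on the sphere of radius `2` by `t + ‖T‖` gives `2 ‖T‖ ≤ t + ‖T‖`.
  have hhalf : opNorm B ≤ (t + opNorm B) / 2 := by
    refine ContinuousLinearMap.opNorm_le_of_unit_norm
      (by linarith [opNorm_nonneg B]) fun x hx => ?_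
    obtain ⟨y, hy, hxy⟩ := hS' ((2 : ℝ) • x) (by rw [norm_smul, hx]; simp)
    have h1 : ‖T ((2 : ℝ) • x)‖ = 2 * ‖T x‖ := by rw [map_smul, norm_smul]; simp
    have h2 : ‖T ((2 : ℝ) • x)‖ ≤ ‖T y‖ + ‖T ((2 : ℝ) • x - y)‖ := by
      have : T ((2 : ℝ) • x) = T y + T ((2 : ℝ) • x - y) := by rw [map_sub]; abel
      rw [this]
      exact norm_add_le _ _
    have h3 : ‖T ((2 : ℝ) • x - y)‖ ≤ opNorm B * 1 :=
      (T.le_opNorm _).trans (mul_le_mul_of_nonneg_left hxy (norm_nonneg _))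
    have h4 := hnet y hy
    change ‖T x‖ ≤ _
    linarith
  linarith

section Probability

variable {Ω : Type*} [MeasurableSpace Ω] {μ : Measure Ω}

lemma hasSubgaussianMGF_mono {X : Ω → ℝ} {c c' : ℝ≥0} (h : HasSubgaussianMGF X c μ)
    (hc : c ≤ c') : HasSubgaussianMGF X c' μ where
  integrable_exp_mul := h.integrable_exp_mul
  mgf_le t := (h.mgf_le t).trans (by gcongr)

variable {n m : ℕ}

/-- A bilinear form of a matrix with independent sub-Gaussian entries is sub-Gaussian. -/
lemma hasSubgaussianMGF_bilin {E : Ω → Matrix (Fin n) (Fin m) ℝ} {v : ℝ≥0}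
    (hindep : iIndepFun (fun (p : Fin n × Fin m) ω => E ω p.1 p.2) μ)
    (hE : ∀ i j, HasSubgaussianMGF (fun ω => E ω i j) v μ)
    {y : EuclideanSpace ℝ (Fin n)} {x : EuclideanSpace ℝ (Fin m)} (hy : ‖y‖ ≤ 2) (hx : ‖x‖ ≤ 2) :
    HasSubgaussianMGF (fun ω => y.ofLp ⬝ᵥ (E ω *ᵥ x.ofLp)) (16 * v) μ := by
  have h1 := HasSubgaussianMGF.sum_of_iIndepFun
    (hindep.comp (fun p r => (y p.1 * x p.2) * r) fun p => by fun_prop)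
    (s := Finset.univ) fun p _ => (hE p.1 p.2).const_mul (y p.1 * x p.2)
  refine hasSubgaussianMGF_mono (h1.congr (Filter.Eventually.of_forall fun ω => ?_)) ?_
  · simp only [dotProduct, Matrix.mulVec, Finset.mul_sum, Fintype.sum_prod_type]
    exact Finset.sum_congr rfl fun i _ => Finset.sum_congr rfl fun j _ => by
      simp only [Function.comp]; ring
  · rw [← NNReal.coe_le_coe, NNReal.coe_sum]
    have h2 : ∑ p : Fin n × Fin m, (y p.1 * x p.2) ^ 2 * (v : ℝ) = ‖y‖ ^ 2 * ‖x‖ ^ 2 * v := by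
      rw [EuclideanSpace.real_norm_sq_eq, EuclideanSpace.real_norm_sq_eq, Finset.sum_mul_sum,
        ← Finset.sum_mul, Fintype.sum_prod_type]
      simp only [mul_pow]
    refine (show _ = _ from h2).trans_le ?_
    have h3 : ‖y‖ ^ 2 * ‖x‖ ^ 2 ≤ 2 ^ 2 * 2 ^ 2 := by gcongr
    push_cast
    have := mul_le_mul_of_nonneg_right h3 v.2
    norm_num at this ⊢
    exact this

/-- Tail bound for the operator norm of a matrix with independent sub-Gaussian entries. -/
lemma measureReal_opNorm_sq_gt_le [IsProbabilityMeasure μ] {E : Ω → Matrix (Fin n) (Fin m) ℝ}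
    {v : ℝ≥0} (hindep : iIndepFun (fun (p : Fin n × Fin m) ω => E ω p.1 p.2) μ)
    (hE : ∀ i j, HasSubgaussianMGF (fun ω => E ω i j) v μ) :
    μ.real {ω | 96 * v * ((n : ℝ) + m) < opNorm (E ω) ^ 2} ≤ Real.exp (-((n : ℝ) + m)) := by
  rcases eq_or_ne v 0 with rfl | hv
  -- The Chernoff bound is void for variance proxy `0`, where the matrix vanishes almost surely.
  · have hzero : ∀ᵐ ω ∂μ, E ω = 0 := by
      have h1 : ∀ i j, ∀ᵐ ω ∂μ, E ω i j = 0 := fun i j =>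
        (hE i j).ae_eq_zero_of_hasSubgaussianMGF_zero
      have h2 : ∀ᵐ ω ∂μ, ∀ i j, E ω i j = 0 := ae_all_iff.2 fun i => ae_all_iff.2 fun j => h1 i j
      filter_upwards [h2] with ω hω
      ext i j
      exact hω i j
    have hnull : μ {ω | 96 * ((0 : ℝ≥0) : ℝ) * ((n : ℝ) + m) < opNorm (E ω) ^ 2} = 0 := by
      refine measure_mono_null (fun ω hω => ?_) (ae_iff.1 hzero)
      intro h0
      simp [h0, opNorm] at hω
    rw [Measure.real, hnull, ENNReal.toReal_zero]
    positivity
  have hv0 : (0 : ℝ) < v := NNReal.coe_pos.2 (pos_iff_ne_zero.2 hv)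
  obtain ⟨S, hScard, hSle, hS⟩ := exists_net (Fin n)
  obtain ⟨S', hScard', hSle', hS'⟩ := exists_net (Fin m)
  rw [Fintype.card_fin] at hScard hScard'
  set t := Real.sqrt (96 * v * ((n : ℝ) + m)) with ht
  have htsq : t ^ 2 = 96 * v * ((n : ℝ) + m) := Real.sq_sqrt (by positivity)
  have hsub : {ω | 96 * v * ((n : ℝ) + m) < opNorm (E ω) ^ 2} ⊆
      ⋃ p ∈ S ×ˢ S', {ω | t ≤ p.1.ofLp ⬝ᵥ (E ω *ᵥ p.2.ofLp)} := by
    intro ω hω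
    by_contra hnot
    simp only [Set.mem_iUnion, Set.mem_ofPred_eq, not_exists, not_le, Finset.mem_product] at hnot
    have h1 : opNorm (E ω) ≤ t := opNorm_le_of_net hS hS' _ (Real.sqrt_nonneg _)
      fun y hy x hx => (hnot (y, x) ⟨hy, hx⟩).le
    have h2 := pow_le_pow_left₀ (opNorm_nonneg _) h1 2
    rw [htsq] at h2
    exact absurd hω (not_lt.2 h2)
  have hterm : ∀ p ∈ S ×ˢ S', μ.real {ω | t ≤ p.1.ofLp ⬝ᵥ (E ω *ᵥ p.2.ofLp)} ≤
      Real.exp (-3 * ((n : ℝ) + m)) := fun p hp => by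
    rw [Finset.mem_product] at hp
    refine ((hasSubgaussianMGF_bilin hindep hE (hSle _ hp.1)
      (hSle' _ hp.2)).measure_ge_le (Real.sqrt_nonneg _)).trans_eq ?_
    rw [← ht, htsq]
    congr 1
    push_cast
    field_simp
    ring
  have h5 : (5 : ℝ) ≤ Real.exp 2 := by
    have h1 := Real.exp_one_gt_d9
    have h2 : Real.exp 2 = Real.exp 1 * Real.exp 1 := by rw [← Real.exp_add]; norm_num
    rw [h2]
    nlinarith
  have hcard : (((S ×ˢ S').card : ℕ) : ℝ) ≤ Real.exp (2 * ((n : ℝ) + m)) := by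
    have h1 : (S ×ˢ S').card ≤ 5 ^ (n + m) := by
      rw [Finset.card_product, pow_add]
      exact Nat.mul_le_mul hScard hScard'
    have h2 : Real.exp (2 * ((n : ℝ) + m)) = Real.exp 2 ^ (n + m) := by
      rw [← Real.exp_nat_mul]
      push_cast
      ring_nf
    rw [h2]
    calc (((S ×ˢ S').card : ℕ) : ℝ) ≤ 5 ^ (n + m) := by exact_mod_cast h1
      _ ≤ Real.exp 2 ^ (n + m) := pow_le_pow_left₀ (by norm_num) h5 _
  calc μ.real {ω | 96 * v * ((n : ℝ) + m) < opNorm (E ω) ^ 2}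
      ≤ μ.real (⋃ p ∈ S ×ˢ S', {ω | t ≤ p.1.ofLp ⬝ᵥ (E ω *ᵥ p.2.ofLp)}) :=
        measureReal_mono hsub (measure_ne_top μ _)
    _ ≤ ∑ p ∈ S ×ˢ S', μ.real {ω | t ≤ p.1.ofLp ⬝ᵥ (E ω *ᵥ p.2.ofLp)} :=
        measureReal_biUnion_finset_le _ _
    _ ≤ (S ×ˢ S').card • Real.exp (-3 * ((n : ℝ) + m)) := Finset.sum_le_card_nsmul _ _ _ hterm
    _ ≤ Real.exp (2 * ((n : ℝ) + m)) * Real.exp (-3 * ((n : ℝ) + m)) := by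
        rw [nsmul_eq_mul]
        gcongr
    _ = Real.exp (-((n : ℝ) + m)) := by rw [← Real.exp_add]; ring_nf

lemma IsModel.measureReal_opNorm_sq_gt_le [IsProbabilityMeasure μ] {K L : ℕ}
    {A : Ω → Matrix (Fin n) (Fin m) ℝ}
    {Λ : Matrix (Fin n) (Fin L) ℝ} {Λ' : Matrix (Fin m) (Fin K) ℝ}
    {c : Fin n → Fin K} {z : Fin m → Fin L} {s : Fin n → Fin m → ℝ≥0}
    (h : IsModel μ A Λ Λ' c z s) :
    μ.real {ω | 96 * maxProxy s * ((n : ℝ) + m) < opNorm (A ω - meanMatrix Λ Λ' c z) ^ 2} ≤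
      Real.exp (-((n : ℝ) + m)) := by
  refine TNPM.measureReal_opNorm_sq_gt_le (E := fun ω => A ω - meanMatrix Λ Λ' c z) ?_ fun i j => ?_
  · exact h.indep.comp (fun p r => r - meanMatrix Λ Λ' c z p.1 p.2) fun p => by fun_prop
  · exact hasSubgaussianMGF_mono (h.subGaussian i j)
      (Finset.le_sup (f := fun p : Fin n × Fin m => s p.1 p.2) (Finset.mem_univ (i, j)))

end Probability

/-! ### Consistency -/

section Consistency

variable {n m K L : ℕ}

lemma frobSq_meanMatrix_pos (hn : 0 < n) (hm : 0 < m)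
    {Λ : Matrix (Fin n) (Fin L) ℝ} {Λ' : Matrix (Fin m) (Fin K) ℝ}
    (hΛ : ∀ i l, 0 < Λ i l) (hΛ' : ∀ j k, 0 < Λ' j k) (c : Fin n → Fin K) (z : Fin m → Fin L) :
    0 < frobSq (meanMatrix Λ Λ' c z) := by
  have : Nonempty (Fin n) := ⟨⟨0, hn⟩⟩
  have : Nonempty (Fin m) := ⟨⟨0, hm⟩⟩
  exact Finset.sum_pos (fun i _ => Finset.sum_pos
    (fun j _ => pow_pos (mul_pos (hΛ _ _) (hΛ' _ _)) 2) Finset.univ_nonempty) Finset.univ_nonempty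

lemma blockOpSq_le_maxBad (B : Matrix (Fin n) (Fin m) ℝ) (c₀ : Fin n → Fin K) (z₀ : Fin m → Fin L)
    {ρ : ℝ} {c : Fin n → Fin K} {z : Fin m → Fin L} (h : (c, z) ∈ badClusterings c₀ z₀ ρ) :
    blockOpSq B c z ≤ maxBadBlockOpSq B c₀ z₀ ρ :=
  le_csSup ((Set.toFinite _).image _).bddAbove ⟨(c, z), h, rfl⟩

lemma mul_le_noiseBound {H₁ H₂ : ℝ} (h₁ : 0 ≤ H₁) (h₂ : 0 ≤ H₂) (n m K L : ℕ) :
    H₁ * (K * L * ((n : ℝ) + m)) ≤ noiseBound H₁ H₂ n m K L := by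
  have hlog : 0 ≤ Real.log (2 * K * L) := by exact_mod_cast Real.log_natCast_nonneg (2 * K * L)
  have hK := Real.log_natCast_nonneg K
  have hL := Real.log_natCast_nonneg L
  have ha : 0 ≤ H₁ * ((n : ℝ) * L + m * K + K * L * Real.log (2 * K * L)) := by positivity
  have hb : 0 ≤ H₂ * (K * L * (n * Real.log K + m * Real.log L)) := by positivity
  unfold noiseBound
  linarith

end Consistency

end TNPM

theorem theorem3 (α : ℝ) (hα : α ∈ Set.Ioo (0 : ℝ) (1 / 2)) :
    ∃ H₁ H₂ : ℝ, 0 < H₁ ∧ 0 < H₂ ∧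
      ∀ (n m K L : ℕ), 0 < n → 0 < m →
      ∀ (Ω : Type*) [MeasurableSpace Ω] (μ : Measure Ω) [IsProbabilityMeasure μ]
        (A : Ω → Matrix (Fin n) (Fin m) ℝ)
        (Λ : Matrix (Fin n) (Fin L) ℝ) (Λ' : Matrix (Fin m) (Fin K) ℝ)
        (c₀ : Fin n → Fin K) (z₀ : Fin m → Fin L) (s : Fin n → Fin m → ℝ≥0),
        TNPM.IsModel μ A Λ Λ' c₀ z₀ s →
        (∀ i l, 0 < Λ i l) → (∀ j k, 0 < Λ' j k) →
        TNPM.InGeneralPosition Λ c₀ → TNPM.InGeneralPosition Λ' z₀ →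
        (K ^ 2 * L ≤ n ∨ L ^ 2 * K ≤ m) →
      ∀ (cHat : Ω → Fin n → Fin K) (zHat : Ω → Fin m → Fin L),
        (∀ ω, TNPM.IsLossMinimizer (A ω) (cHat ω) (zHat ω)) →
      ∀ ρ ∈ Set.Ioo (0 : ℝ) 1,
        (TNPM.maxProxy s : ℝ) * TNPM.noiseBound H₁ H₂ n m K L ≤
          TNPM.frobSq (TNPM.meanMatrix Λ Λ' c₀ z₀) -
            (1 + α) * TNPM.maxBadBlockOpSq (TNPM.meanMatrix Λ Λ' c₀ z₀) c₀ z₀ ρ →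
        1 - 2 * Real.exp (-((n : ℝ) + m)) ≤
          μ.real {ω | max (TNPM.err (cHat ω) c₀) (TNPM.err (zHat ω) z₀) ≤ ρ} := by
  -- With `δ = α / 4`, `(1 + δ)² ≤ 1 + 3 α / 4` leaves room below the factor `1 + α`.
  have hα0 : 0 < α := hα.1
  have hα1 : α < 1 / 2 := hα.2
  set δ : ℝ := α / 4 with hδ
  have hδ0 : 0 < δ := by positivity
  set D : ℝ := 2 * ((1 + δ) * (1 + δ⁻¹)) with hD
  have hD0 : 0 < D := by positivity
  refine ⟨192 * D, 1, by positivity, one_pos, ?_⟩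
  intro n m K L hn hm Ω _ μ _ A Λ Λ' c₀ z₀ s hmodel hΛ hΛ' _ _ _ cHat zHat hmin ρ _ hsep
  set P := TNPM.meanMatrix Λ Λ' c₀ z₀
  set G := {ω | max (TNPM.err (cHat ω) c₀) (TNPM.err (zHat ω) z₀) ≤ ρ}
  set N := {ω | 96 * TNPM.maxProxy s * ((n : ℝ) + m) < TNPM.opNorm (A ω - P) ^ 2}
  have hN : μ.real N ≤ Real.exp (-((n : ℝ) + m)) := hmodel.measureReal_opNorm_sq_gt_le
  have hcover : (Set.univ : Set Ω) ⊆ G ∪ N := by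
    intro ω _
    by_contra hω
    rw [Set.mem_union, not_or] at hω
    have hbad : (cHat ω, zHat ω) ∈ TNPM.badClusterings c₀ z₀ ρ := by
      have h : ¬ max (TNPM.err (cHat ω) c₀) (TNPM.err (zHat ω) z₀) ≤ ρ := hω.1
      exact (not_le.1 h).le
    have hE : TNPM.opNorm (A ω - P) ^ 2 ≤ 96 * TNPM.maxProxy s * ((n : ℝ) + m) := not_lt.1 hω.2
    have hbasic := TNPM.frobSq_meanMatrix_le_of_isLossMinimizer Λ Λ' c₀ z₀ (hmin ω) hδ0
    have hB := TNPM.blockOpSq_le_maxBad P c₀ z₀ hbad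
    have hB0 := TNPM.blockOpSq_nonneg P (cHat ω) (zHat ω)
    have hP := TNPM.frobSq_meanMatrix_pos hn hm hΛ hΛ' c₀ z₀
    have hnoise := mul_le_mul_of_nonneg_left
      (TNPM.mul_le_noiseBound (H₁ := 192 * D) (H₂ := 1) (by positivity) zero_le_one n m K L)
      (NNReal.coe_nonneg (TNPM.maxProxy s))
    have hX : D * (K * L * TNPM.opNorm (A ω - P) ^ 2) ≤
        D * (K * L * (96 * TNPM.maxProxy s * ((n : ℝ) + m))) := by gcongr
    have hX0 : 0 ≤ D * (K * L * TNPM.opNorm (A ω - P) ^ 2) := by positivity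
    set X := D * (K * L * TNPM.opNorm (A ω - P) ^ 2)
    set b := TNPM.blockOpSq P (cHat ω) (zHat ω)
    set M := TNPM.maxBadBlockOpSq P c₀ z₀ ρ
    have hlow : (1 + α) * b + 2 * X ≤ TNPM.frobSq P := by
      have h1 : (1 + α) * b ≤ (1 + α) * M := by gcongr
      have h2 : 2 * X ≤ (TNPM.maxProxy s : ℝ) * TNPM.noiseBound (192 * D) 1 n m K L :=
        le_trans (by linarith) hnoise
      linarith
    have hupp : TNPM.frobSq P ≤ (1 + 3 * α / 4) * b + X := by
      have h1 : (1 + δ) ^ 2 * b ≤ (1 + 3 * α / 4) * b :=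
        mul_le_mul_of_nonneg_right (by rw [hδ]; nlinarith) hB0
      exact hbasic.trans (by gcongr)
    -- `(1 + α) hupp - (1 + 3 α / 4) hlow` bounds `(α / 4) ‖P‖²` by a nonpositive multiple of `X`.
    have h1 := mul_le_mul_of_nonneg_left hupp (show 0 ≤ 1 + α by linarith)
    have h2 := mul_le_mul_of_nonneg_left hlow (show 0 ≤ 1 + 3 * α / 4 by linarith)
    have h3 : 0 < α * TNPM.frobSq P := mul_pos hα0 hP
    have h4 : 0 ≤ α * X := mul_nonneg hα0.le hX0
    nlinarith
  have hone : 1 ≤ μ.real G + μ.real N := by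
    have h1 : μ.real Set.univ ≤ μ.real (G ∪ N) := measureReal_mono hcover
    rw [probReal_univ] at h1
    exact h1.trans (measureReal_union_le _ _)
  linarith [Real.exp_pos (-((n : ℝ) + m))]
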